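/- Let $T$ be a group with a topology for which multiplication is jointly continuous, and let $(T,X)$ be a flow on a non-empty compact Hausdorff space $X$, that is, a jointly continuous action $T\times X\to X$, $(t,x)\mapsto tx$. A point $x\in X$ is called almost automorphic (a.a.) if for every net $\{t_n\}$ in $T$, every net $\{x_n'\}$ in $X$ over the same directed set and all $y,x'\in X$, the relations $t_nx\to y$, $x_n'\to x'$ and $t_nx_n'=y$ for all $n$ (i.e. $x_n'=t_n^{-1}y$) imply $x=x'$; let $P_{aa}(T,X)$ be the set of a.a. points. The flow $(T,X)$ is called a.a. if there is a point $x\in P_{aa}(T,X)$ with dense orbit $Tx$. A flow is minimal if all its orbits are dense. Theorem (Veech's structure theorem for a.a. flows). Let $(T,X)$ be an a.a. flow. Then there are a flow $(T,Y)$ on a compact Hausdorff space $Y$ and a map $\pi\colon X\to Y$ such that 1. $(T,Y)$ is equicontinuous, i.e. for every $y\in Y$ and every entourage $\varepsilon$ of the unique uniformity of $Y$ there is a neighbourhood $V$ of $y$ with $(ty,ty')\in\varepsilon$ for all $t\in T$ and $y'\in V$; 2. $(T,X)$ is an almost 1-1 extension of $(T,Y)$ via $\pi$, i.e. $(T,X)$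 and $(T,Y)$ are minimal, $\pi$ is continuous and surjective with $\pi(tx)=t\pi(x)$ for all $t\in T$, $x\in X$, and there is $y\in Y$ for which $\pi^{-1}[y]$ is a singleton; 3. $P_{aa}(T,X)=\{x\in X : \pi^{-1}[\pi(x)]=\{x\}\}$. -/

import Mathlib

open Filter Topology

universe u v w

namespace AAFlow

/-- Almost automorphic points of a semiflow `(T, X)`: for every net `t` in `T` and every net `x'`
in `X` over the same directed set, if `t n • x → y`, `x' n → x₁` and `t n • x' n = y` for all `n`,
then `x = x₁`. The universe of the directed sets is large enough for every filter on `T` and on `X`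
to be the tail filter of a net; see `isAAPoint_iff_filter`. -/
def IsAAPoint (T : Type u) {X : Type v} [Monoid T] [TopologicalSpace X] [MulAction T X]
    (x : X) : Prop :=
  ∀ (ι : Type (max u v)) [Preorder ι] [IsDirectedOrder ι] [Nonempty ι]
    (t : ι → T) (x' : ι → X) (y x₁ : X),
    Tendsto (fun n => t n • x) atTop (𝓝 y) → Tendsto x' atTop (𝓝 x₁) →
      (∀ n, t n • x' n = y) → x = x₁

/-- The set of almost automorphic points of `(T, X)`. -/
def aaPoints (T : Type u) (X : Type v) [Monoid T] [TopologicalSpace X] [MulAction T X] : Set X :=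
  {x | IsAAPoint T x}

/-- `(T, X)` is almost automorphic if some almost automorphic point has a dense orbit. -/
def IsAASemiflow (T : Type u) (X : Type v) [Monoid T] [TopologicalSpace X] [MulAction T X] :
    Prop :=
  ∃ x ∈ aaPoints T X, closure (MulAction.orbit T x) = Set.univ

/-- `(T, Y)` is equicontinuous: the family of its transition maps is equicontinuous at every
point. On a compact Hausdorff space the uniform structure is determined by the topology. -/
def IsEquicontinuousSemiflow (T : Type u) (Y : Type v) [Monoid T] [UniformSpace Y]
    [MulAction T Y] : Prop :=
  Equicontinuous (fun (t : T) (y : Y) => t • y)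

/-- Epimorphisms of semiflows: continuous equivariant surjections. -/
structure IsEpimorphism (T : Type u) {X : Type v} {Y : Type w} [Monoid T] [TopologicalSpace X]
    [TopologicalSpace Y] [MulAction T X] [MulAction T Y] (π : X → Y) : Prop where
  continuous : Continuous π
  surjective : Function.Surjective π
  map_smul : ∀ (t : T) (x : X), π (t • x) = t • π x

/-- `π` exhibits the minimal semiflow `(T, X)` as an almost 1-1 extension of the minimal semiflow
`(T, Y)`: it is an epimorphism with at least one singleton fibre. -/
structure IsAlmostOneToOneExtension (T : Type u) {X : Type v} {Y : Type w} [Monoid T]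
    [TopologicalSpace X] [TopologicalSpace Y] [MulAction T X] [MulAction T Y] (π : X → Y) :
    Prop where
  minimal_source : MulAction.IsMinimal T X
  minimal_target : MulAction.IsMinimal T Y
  epimorphism : IsEpimorphism T π
  exists_singleton_fibre : ∃ (y : Y) (x : X), π ⁻¹' {y} = {x}

/-- For a group action, nets may be replaced by filters on `T`, and `x' n` is `(t n)⁻¹ • y`. -/
theorem isAAPoint_iff_filter {T : Type u} {X : Type v} [Group T] [TopologicalSpace X]
    [MulAction T X] (x : X) :
    IsAAPoint T x ↔ ∀ (l : Filter T) [l.NeBot] (y x₁ : X),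
      Tendsto (fun t : T => t • x) l (𝓝 y) → Tendsto (fun t : T => t⁻¹ • y) l (𝓝 x₁) →
        x = x₁ := by
  constructor
  · intro h l _ y x₁ h1 h2
    let I := {p : T × (Set T)ᵒᵈ // OrderDual.ofDual p.2 ∈ l ∧ p.1 ∈ OrderDual.ofDual p.2}
    let _ : Preorder I := Preorder.lift (fun p : I => p.1.2)
    have hne : Nonempty I := by
      obtain ⟨t, ht⟩ := (inferInstance : l.NeBot).nonempty_of_mem univ_mem
      exact ⟨⟨(t, OrderDual.toDual Set.univ), univ_mem, ht⟩⟩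
    have hdir : IsDirectedOrder (ULift.{max u v} I) := ⟨by
      rintro ⟨⟨⟨a, A⟩, hA, ha⟩⟩ ⟨⟨⟨b, B⟩, hB, hb⟩⟩
      obtain ⟨t, ht⟩ := (inferInstance : l.NeBot).nonempty_of_mem (inter_mem hA hB)
      exact ⟨⟨⟨(t, OrderDual.toDual (OrderDual.ofDual A ∩ OrderDual.ofDual B)),
        inter_mem hA hB, ht⟩⟩, Set.inter_subset_left, Set.inter_subset_right⟩⟩
    have key : Tendsto (fun n : ULift.{max u v} I => n.down.1.1) atTop l := by
      intro S hS
      obtain ⟨t, ht⟩ := (inferInstance : l.NeBot).nonempty_of_mem hS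
      refine mem_map.2 (mem_atTop_sets.2 ⟨⟨⟨(t, OrderDual.toDual S), hS, ht⟩⟩, ?_⟩)
      rintro ⟨⟨⟨b, B⟩, hB, hb⟩⟩ hle
      exact (show OrderDual.ofDual B ⊆ S from hle) hb
    exact h (ULift.{max u v} I) (fun n => n.down.1.1) (fun n => (n.down.1.1)⁻¹ • y) y x₁
      (h1.comp key) (h2.comp key) (fun n => smul_inv_smul _ _)
  · intro h ι _ _ _ t x' y x₁ h1 h2 h3
    refine h (map t atTop) y x₁ (tendsto_map'_iff.2 h1) (tendsto_map'_iff.2 ?_)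
    refine h2.congr fun n => ?_
    simp [← h3 n]

end AAFlow

namespace AAFlow

open Set Uniformity

/-! ### Recurrence of a.a. points -/

section Recurrence

variable {T : Type u} {X : Type v} [Group T] [TopologicalSpace X] [MulAction T X]

/-! Call two points close if one group element carries both into a given non-empty open set. These
relations are open and `T`-invariant; if they generate a uniformity, `T` acts on it uniformly
equicontinuously, and `Y` is its Hausdorff quotient. The crux is the triangle inequality: the
recurrence lemma `IsAAPoint.exists_nhds_inv_mul` gives it along one a.a. orbit, and density of the
orbit spreads it (`IsAAPoint.exists_jointEntry_small`). The same estimate makes fibres of a.a.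
points singletons. Conversely, by invariance `t • p → y` and `t⁻¹ • y → x₁` force `π p = π x₁`. -/

theorem IsAAPoint.smul [ContinuousConstSMul T X] {x : X} (hx : IsAAPoint T x) (g : T) :
    IsAAPoint T (g • x) := by
  intro ι _ _ _ t x' y x₁ h1 h2 h3
  have := hx ι (fun n => t n * g) (fun n => g⁻¹ • x' n) y (g⁻¹ • x₁)
    (by simpa [mul_smul] using h1) (h2.const_smul g⁻¹) (fun n => by simp [mul_smul, h3 n])
  rw [this, smul_inv_smul]

/-- A flow on a compact space with an almost automorphic point of dense orbit is minimal. -/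
theorem IsAAPoint.isMinimal [CompactSpace X] [ContinuousConstSMul T X] {x : X}
    (hx : IsAAPoint T x) (hd : Dense (MulAction.orbit T x)) : MulAction.IsMinimal T X := by
  rw [isAAPoint_iff_filter] at hx
  refine ⟨fun y => ?_⟩
  have hy : x ∈ closure (MulAction.orbit T y) := by
    have hm : y ∈ closure (range fun t : T => t • x) := hd y
    obtain ⟨l, hly⟩ : ∃ l : Ultrafilter T,
        Tendsto (fun t : T => t • x) l (𝓝 y) := by
      have : NeBot (comap (fun t : T => t • x) (𝓝 y)) := by
        rw [comap_neBot_iff]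
        intro s hs
        obtain ⟨_, h1, t, rfl⟩ := mem_closure_iff_nhds.1 hm s hs
        exact ⟨t, h1⟩
      exact ⟨Ultrafilter.of _, tendsto_comap.mono_left (Ultrafilter.of_le _)⟩
    -- Going back along `l` from `y` must lead to `x`, so `x` is in the orbit closure of `y`.
    obtain ⟨x₁, -, hx₁⟩ := isCompact_univ.ultrafilter_le_nhds (l.map fun t : T => t⁻¹ • y)
      (by simp)
    have : x = x₁ := hx l y x₁ hly hx₁
    subst this
    exact mem_closure_of_tendsto (f := fun t : T => t⁻¹ • y) hx₁
      (Eventually.of_forall fun t => ⟨t⁻¹, rfl⟩)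
  refine dense_iff_closure_eq.2 (eq_univ_of_univ_subset ?_)
  rw [← hd.closure_eq]
  refine closure_minimal ?_ isClosed_closure
  rintro _ ⟨t, rfl⟩
  rw [mem_closure_iff] at hy ⊢
  intro o ho hto
  obtain ⟨_, h1, s, rfl⟩ := hy ((fun z => t • z) ⁻¹' o) (ho.preimage (continuous_const_smul t)) hto
  exact ⟨_, h1, t * s, by simp [mul_smul]⟩

/-- Return times of an almost automorphic point to a small neighbourhood have quotients which are
return times to a prescribed neighbourhood. -/
theorem IsAAPoint.exists_nhds_inv_mul [CompactSpace X] [T2Space X] [ContinuousConstSMul T X]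
    {p : X} (hp : IsAAPoint T p) {U : Set X} (hU : IsOpen U) (hpU : p ∈ U) :
    ∃ V : Set X, IsOpen V ∧ p ∈ V ∧
      ∀ s t : T, s • p ∈ V → t • p ∈ V → (s⁻¹ * t) • p ∈ U := by
  rw [isAAPoint_iff_filter] at hp
  by_contra! hcon
  choose! s t hs ht hst using hcon
  obtain ⟨K, hK, hKc, hKU⟩ := exists_mem_nhds_isClosed_subset (hU.mem_nhds hpU)
  -- The last condition makes `(s V)⁻¹ * t V` carry the new set off `K`; the middle one makes `t V`
  -- carry it into `V`.
  let next : Set X → Set X := fun V =>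
    V ∩ ((fun z => t V • z) ⁻¹' V) ∩ ((fun z => ((s V)⁻¹ * t V) • z) ⁻¹' Kᶜ)
  let V : ℕ → Set X := fun n => next^[n] univ
  have hVs : ∀ n, V (n + 1) = next (V n) := fun n => Function.iterate_succ_apply' _ _ _
  have hV : ∀ n, IsOpen (V n) ∧ p ∈ V n := by
    intro n
    induction n with
    | zero => exact ⟨isOpen_univ, mem_univ _⟩
    | succ n ih =>
      rw [hVs]
      refine ⟨(ih.1.inter (ih.1.preimage (continuous_const_smul _))).inter
        (hKc.isOpen_compl.preimage (continuous_const_smul _)), ⟨ih.2, ht _ ih.1 ih.2⟩, ?_⟩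
      exact fun h => hst _ ih.1 ih.2 (hKU h)
  let h : ℕ → T := fun n => Nat.rec 1 (fun k a => a * t (V k)) n
  have hhs : ∀ n, h (n + 1) = h n * t (V n) := fun n => rfl
  have hmove : ∀ k m z, z ∈ V (m + k) → ((h m)⁻¹ * h (m + k)) • z ∈ V m := by
    intro k
    induction k with
    | zero => intro m z hz; simpa using hz
    | succ k ih =>
      intro m z hz
      rw [← add_assoc, hVs] at hz
      have := ih m _ hz.1.2
      rwa [smul_smul, mul_assoc, ← hhs] at this
  -- For `m < n`, `(g m)⁻¹ * g n` is `(s (V m))⁻¹ * t (V m)` after a move of `s (V n) • p` into `V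
  -- (m + 1)`.
  let g : ℕ → T := fun n => h n * s (V n)
  have hg : ∀ m k, ((g m)⁻¹ * g (m + 1 + k)) • p ∉ K := by
    intro m k
    have h1 := hmove k (m + 1) _ (hs _ (hV (m + 1 + k)).1 (hV (m + 1 + k)).2)
    rw [hVs] at h1
    have h2 := h1.2
    rw [mem_preimage, smul_smul, smul_smul, hhs] at h2
    convert h2 using 2
    simp only [g]
    group
  obtain ⟨y, -, hy⟩ := isCompact_univ.ultrafilter_le_nhds
    ((hyperfilter ℕ).map fun n => g n • p) (by simp)
  obtain ⟨x₁, -, hx₁⟩ := isCompact_univ.ultrafilter_le_nhds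
    ((hyperfilter ℕ).map fun n => (g n)⁻¹ • y) (by simp)
  have hy' : Tendsto (fun n => g n • p) (hyperfilter ℕ) (𝓝 y) := hy
  have hx' : Tendsto (fun n => (g n)⁻¹ • y) (hyperfilter ℕ) (𝓝 x₁) := hx₁
  have heq : p = x₁ := hp (map g (hyperfilter ℕ)) y x₁ (tendsto_map'_iff.2 hy')
    (tendsto_map'_iff.2 hx')
  subst heq
  -- Let `n` tend to infinity with `m` fixed; then `m` to infinity contradicts `(g m)⁻¹ • y → p`.
  have hmem : ∀ m, (g m)⁻¹ • y ∈ (interior K)ᶜ := by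
    intro m
    refine isOpen_interior.isClosed_compl.mem_of_tendsto (hy'.const_smul (g m)⁻¹) ?_
    have : ∀ᶠ n in (hyperfilter ℕ : Filter ℕ), m + 1 ≤ n :=
      Nat.hyperfilter_le_atTop (eventually_ge_atTop _)
    filter_upwards [this] with n hn hmK
    obtain ⟨k, rfl⟩ := Nat.exists_eq_add_of_le hn
    rw [smul_smul] at hmK
    exact hg m k (interior_subset hmK)
  exact isOpen_interior.isClosed_compl.mem_of_tendsto hx' (Eventually.of_forall hmem)
    (mem_interior_iff_mem_nhds.2 hK)

end Recurrence

/-! ### The invariant uniformity -/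

section Uniformity

variable (T : Type u) {X : Type v} [Group T] [MulAction T X]

/-- The pairs of points which are moved into `V` by a common element of the group. -/
def jointEntry (V : Set X) : Set (X × X) :=
  {q | ∃ g : T, g • q.1 ∈ V ∧ g • q.2 ∈ V}

variable {T}

theorem jointEntry_mono {V W : Set X} (h : V ⊆ W) : jointEntry T V ⊆ jointEntry T W :=
  fun _ ⟨g, h1, h2⟩ => ⟨g, h h1, h h2⟩

theorem jointEntry_preimage_subset (V : Set X) (g : T) :
    jointEntry T ((fun z => g • z) ⁻¹' V) ⊆ jointEntry T V :=
  fun _ ⟨f, h1, h2⟩ => ⟨g * f, by simpa [mul_smul] using h1, by simpa [mul_smul] using h2⟩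

theorem smul_mem_jointEntry {V : Set X} {a b : X} (h : (a, b) ∈ jointEntry T V) (t : T) :
    (t • a, t • b) ∈ jointEntry T V := by
  obtain ⟨g, h1, h2⟩ := h
  exact ⟨g * t⁻¹, by simpa [mul_smul] using h1, by simpa [mul_smul] using h2⟩

theorem swap_mem_jointEntry {V : Set X} {a b : X} (h : (a, b) ∈ jointEntry T V) :
    (b, a) ∈ jointEntry T V :=
  let ⟨g, h1, h2⟩ := h
  ⟨g, h2, h1⟩

variable [TopologicalSpace X]

theorem diag_mem_jointEntry [MulAction.IsMinimal T X] {V : Set X} (hV : IsOpen V)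
    (hne : V.Nonempty) (a : X) : (a, a) ∈ jointEntry T V :=
  let ⟨g, hg⟩ := hV.exists_smul_mem T a hne
  ⟨g, hg, hg⟩

theorem isOpen_jointEntry [ContinuousConstSMul T X] {V : Set X} (hV : IsOpen V) :
    IsOpen (jointEntry T V) := by
  have : jointEntry T V = ⋃ g : T, ((fun z : X => g • z) ⁻¹' V) ×ˢ ((fun z => g • z) ⁻¹' V) := by
    ext; simp [jointEntry]
  rw [this]
  exact isOpen_iUnion fun g => (hV.preimage (continuous_const_smul g)).prod
    (hV.preimage (continuous_const_smul g))

variable [CompactSpace X] [T2Space X] [ContinuousConstSMul T X] [MulAction.IsMinimal T X]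

/-- The triangle inequality for joint entry. Approximate `b` by `t • p` and `c` by `s • p`; two uses
of recurrence then control `f * s = (f * t) * (t⁻¹ * s)` at `p`. -/
theorem IsAAPoint.exists_jointEntry_small {p : X} (hp : IsAAPoint T p) {U : Set X}
    (hU : IsOpen U) (hpU : p ∈ U) :
    ∃ V : Set X, IsOpen V ∧ p ∈ V ∧ V ⊆ U ∧
      ∀ f g : T, ∀ b c : X, f • b ∈ V → g • b ∈ V → g • c ∈ V → f • c ∈ U := by
  obtain ⟨K, hK, hKc, hKU⟩ := exists_mem_nhds_isClosed_subset (hU.mem_nhds hpU)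
  obtain ⟨V₁, hV₁, hp₁, h₁⟩ :=
    hp.exists_nhds_inv_mul isOpen_interior (mem_interior_iff_mem_nhds.2 hK)
  obtain ⟨V₂, hV₂, hp₂, h₂⟩ := hp.exists_nhds_inv_mul hV₁ hp₁
  refine ⟨V₂ ∩ U, hV₂.inter hU, ⟨hp₂, hpU⟩, inter_subset_right, ?_⟩
  intro f g b c hfb hgb hgc
  have hfgo : IsOpen ((fun z : X => f • z) ⁻¹' V₂ ∩ (fun z => g • z) ⁻¹' V₂) :=
    (hV₂.preimage (continuous_const_smul f)).inter (hV₂.preimage (continuous_const_smul g))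
  obtain ⟨t, htf, htg⟩ := hfgo.exists_smul_mem T p ⟨b, hfb.1, hgb.1⟩
  simp only [mem_preimage, smul_smul] at htf htg
  apply hKU
  rw [← hKc.closure_eq, mem_closure_iff]
  intro o ho hco
  have hfgo' : IsOpen ((fun z : X => f • z) ⁻¹' o ∩ (fun z => g • z) ⁻¹' V₂) :=
    (ho.preimage (continuous_const_smul f)).inter (hV₂.preimage (continuous_const_smul g))
  obtain ⟨s, hsf, hsg⟩ := hfgo'.exists_smul_mem T p ⟨c, hco, hgc.1⟩
  simp only [mem_preimage, smul_smul] at hsf hsg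
  refine ⟨_, hsf, interior_subset ?_⟩
  have h3 := h₁ (f * t)⁻¹ ((g * t)⁻¹ * (g * s)) (by simpa using h₂ (f * t) 1 htf (by simpa))
    (h₂ _ _ htg hsg)
  convert h3 using 2
  group

/-- The uniformity generated by the sets `jointEntry T V`, for `V` open and non-empty. -/
noncomputable def jointEntryCore {x : X} (hx : IsAAPoint T x) : UniformSpace.Core X :=
  UniformSpace.Core.mkOfBasis
    { sets := {E | ∃ V : Set X, IsOpen V ∧ V.Nonempty ∧ E = jointEntry T V}
      nonempty := ⟨_, univ, isOpen_univ, ⟨x, mem_univ x⟩, rfl⟩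
      inter_sets := by
        rintro _ _ ⟨V, hV, ⟨v, hv⟩, rfl⟩ ⟨W, hW, hWne, rfl⟩
        -- `W` may miss `V`, but a translate of `W` meets it and gives no larger a relation.
        obtain ⟨g, hg⟩ := hW.exists_smul_mem T v hWne
        exact ⟨_, ⟨V ∩ (fun z => g • z) ⁻¹' W, hV.inter (hW.preimage (continuous_const_smul g)),
          ⟨v, hv, hg⟩, rfl⟩, subset_inter (jointEntry_mono inter_subset_left)
          ((jointEntry_mono inter_subset_right).trans (jointEntry_preimage_subset W g))⟩ }
    (by
      rintro _ ⟨V, hV, hne, rfl⟩ a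
      exact diag_mem_jointEntry hV hne a)
    (by
      rintro _ ⟨V, hV, hne, rfl⟩
      exact ⟨_, ⟨V, hV, hne, rfl⟩, fun q hq => swap_mem_jointEntry hq⟩)
    (by
      rintro _ ⟨U, hU, hne, rfl⟩
      -- `U` need not contain `x`, but it contains a translate, which is again a.a.
      obtain ⟨g, hg⟩ := hU.exists_smul_mem T x hne
      obtain ⟨V, hV, hpV, hVU, h⟩ := (hx.smul g).exists_jointEntry_small hU hg
      refine ⟨_, ⟨V, hV, ⟨_, hpV⟩, rfl⟩, ?_⟩
      rintro ⟨a, c⟩ ⟨b, ⟨f, hfa, hfb⟩, ⟨k, hkb, hkc⟩⟩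
      exact ⟨f, hVU hfa, h f k b c hfb hkb hkc⟩)

theorem mem_jointEntryCore {x : X} (hx : IsAAPoint T x) {E : Set (X × X)} :
    E ∈ (jointEntryCore hx).uniformity ↔
      ∃ V : Set X, IsOpen V ∧ V.Nonempty ∧ jointEntry T V ⊆ E := by
  change E ∈ FilterBasis.filter _ ↔ _
  rw [FilterBasis.mem_filter_iff]
  constructor
  · rintro ⟨_, ⟨V, hV, hne, rfl⟩, h⟩
    exact ⟨V, hV, hne, h⟩
  · rintro ⟨V, hV, hne, h⟩
    exact ⟨_, ⟨V, hV, hne, rfl⟩, h⟩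

/-- An almost automorphic point of a minimal flow is the only point which is not separated from it
by the sets `jointEntry T V`. -/
theorem IsAAPoint.eq_of_forall_mem_jointEntry {p z : X} (hp : IsAAPoint T p)
    (h : ∀ V : Set X, IsOpen V → V.Nonempty → (p, z) ∈ jointEntry T V) : z = p := by
  by_contra hne
  obtain ⟨U, W, hU, hW, hpU, hzW, hUW⟩ := t2_separation (Ne.symm hne)
  obtain ⟨V, hV, hpV, hVU, hs⟩ := hp.exists_jointEntry_small hU hpU
  obtain ⟨g, hgp, hgz⟩ := h V hV ⟨p, hpV⟩
  exact disjoint_left.1 hUW (by simpa using hs 1 g p z (by simpa) hgp hgz) hzW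

end Uniformity

/-! ### The Hausdorff quotient -/

section Quotient

variable {T : Type u} {X : Type v} {Z : Type w} [Group T] [TopologicalSpace T]
  [TopologicalSpace X] [CompactSpace X] [MulAction T X] [ContinuousSMul T X]
  [UniformSpace Z] [MulAction T Z]

/-- A uniformly equicontinuous image of a flow on a compact space has a compact Hausdorff
equicontinuous quotient. -/
theorem IsEpimorphism.exists_separated {q : X → Z} (hq : IsEpimorphism T q)
    (he : UniformEquicontinuous fun (t : T) (z : Z) => t • z) :
    ∃ (Y : Type w) (_ : UniformSpace Y) (_ : CompactSpace Y) (_ : T2Space Y)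
      (_ : MulAction T Y) (_ : ContinuousSMul T Y) (π : X → Y),
      IsEquicontinuousSemiflow T Y ∧ IsEpimorphism T π ∧
      ∀ a b, π a = π b ↔ ∀ E ∈ 𝓤 Z, (q a, q b) ∈ E := by
  have : ContinuousConstSMul T Z := ⟨fun t => he.equicontinuous.continuous t⟩
  let π : X → SeparationQuotient Z := fun a => SeparationQuotient.mk (q a)
  have hπ : IsEpimorphism T π :=
    ⟨SeparationQuotient.continuous_mk.comp hq.continuous,
      SeparationQuotient.surjective_mk.comp hq.surjective, fun t a => by
        simp [π, hq.map_smul]⟩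
  have hcompact : CompactSpace (SeparationQuotient Z) := ⟨by
    rw [← hπ.surjective.range_eq]; exact isCompact_range hπ.continuous⟩
  have hsmul : ContinuousSMul T (SeparationQuotient Z) := ⟨by
    -- `π` is proper, so its product with the identity of `T` is closed and joint continuity
    -- descends.
    have hquot : IsQuotientMap (Prod.map (id : T → T) π) :=
      (isProperMap_id.prodMap hπ.continuous.isProperMap).isClosedMap.isQuotientMap
        (continuous_id.prodMap hπ.continuous) (Function.surjective_id.prodMap hπ.surjective)
    rw [hquot.continuous_iff]
    have : (fun r : T × SeparationQuotient Z => r.1 • r.2) ∘ Prod.map (id : T → T) π =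
        fun r : T × X => π (r.1 • r.2) := by
      ext r; simp [hπ.map_smul]
    rw [this]
    exact hπ.continuous.comp continuous_smul⟩
  refine ⟨SeparationQuotient Z, inferInstance, hcompact, inferInstance, inferInstance,
    hsmul, π, ?_, hπ, fun a b => ?_⟩
  · refine UniformEquicontinuous.equicontinuous fun E hE => ?_
    rw [SeparationQuotient.uniformity_eq, mem_map] at hE
    rw [SeparationQuotient.uniformity_eq, eventually_map]
    filter_upwards [he _ hE] with r hr t
    exact hr t
  · rw [SeparationQuotient.mk_eq_mk, inseparable_iff_ker_uniformity]
    simp [Filter.ker_def]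

end Quotient

end AAFlow

open AAFlow in
theorem theorem0p13 {T : Type u} {X : Type v}
    [Group T] [TopologicalSpace T] [ContinuousMul T]
    [TopologicalSpace X] [CompactSpace X] [T2Space X]
    [MulAction T X] [ContinuousSMul T X]
    (hX : AAFlow.IsAASemiflow T X) :
    ∃ (Y : Type v) (_ : UniformSpace Y) (_ : CompactSpace Y) (_ : T2Space Y)
      (_ : MulAction T Y) (_ : ContinuousSMul T Y) (π : X → Y),
      AAFlow.IsEquicontinuousSemiflow T Y ∧
      AAFlow.IsAlmostOneToOneExtension T π ∧
      AAFlow.aaPoints T X = {x : X | π ⁻¹' {π x} = {x}} := by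
  obtain ⟨x₀, hx₀, hd⟩ := hX
  change IsAAPoint T x₀ at hx₀
  have hmin : MulAction.IsMinimal T X := hx₀.isMinimal (dense_iff_closure_eq.2 hd)
  let Z : UniformSpace X := UniformSpace.ofCore (jointEntryCore hx₀)
  have hZ : ∀ E : Set (X × X), E ∈ Z.uniformity ↔
      ∃ V : Set X, IsOpen V ∧ V.Nonempty ∧ jointEntry T V ⊆ E :=
    fun E => mem_jointEntryCore hx₀
  have hepi : @IsEpimorphism T X X _ _ Z.toTopologicalSpace _ _ id := by
    refine @IsEpimorphism.mk T X X _ _ Z.toTopologicalSpace _ _ id ?_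
      Function.surjective_id (fun _ _ => rfl)
    refine continuous_id_iff_le.2 (le_of_nhds_le_nhds fun a => ?_)
    intro s hs
    rw [@nhds_eq_comap_uniformity X Z, mem_comap] at hs
    obtain ⟨E, hE, hEs⟩ := hs
    obtain ⟨V, hV, hne, hVE⟩ := (hZ E).1 hE
    refine mem_of_superset (((isOpen_jointEntry (T := T) hV).preimage
      (Continuous.prodMk_right a)).mem_nhds (diag_mem_jointEntry hV hne a)) ?_
    exact fun b hb => hEs (hVE hb)
  have heq : @UniformEquicontinuous T X X Z Z fun (t : T) (z : X) => t • z := by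
    intro E hE
    obtain ⟨V, hV, hne, hVE⟩ := (hZ E).1 hE
    exact mem_of_superset ((hZ _).2 ⟨V, hV, hne, subset_rfl⟩)
      fun r hr t => hVE (smul_mem_jointEntry hr t)
  obtain ⟨Y, i1, i2, i3, i4, i5, π, hY, hπ, hker⟩ :=
    @IsEpimorphism.exists_separated T X X _ _ _ _ _ _ Z _ id hepi heq
  have hker' : ∀ a b, π a = π b ↔
      ∀ V : Set X, IsOpen V → V.Nonempty → (a, b) ∈ jointEntry T V := by
    intro a b
    rw [hker]
    constructor
    · exact fun h V hV hne => h _ ((hZ _).2 ⟨V, hV, hne, subset_rfl⟩)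
    · intro h E hE
      obtain ⟨V, hV, hne, hVE⟩ := (hZ E).1 hE
      exact hVE (h V hV hne)
  have hfib : ∀ p, IsAAPoint T p → π ⁻¹' {π p} = {p} := by
    intro p hp
    ext z
    refine ⟨fun hz => hp.eq_of_forall_mem_jointEntry ((hker' p z).1 (Eq.symm hz)), ?_⟩
    rintro rfl
    rfl
  refine ⟨Y, i1, i2, i3, i4, i5, π, hY, ⟨hmin, ⟨fun y => ?_⟩, hπ, π x₀, x₀, hfib x₀ hx₀⟩, ?_⟩
  · obtain ⟨a, rfl⟩ := hπ.surjective y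
    have := hπ.surjective.denseRange.dense_image hπ.continuous (MulAction.dense_orbit T a)
    refine this.mono ?_
    rintro _ ⟨_, ⟨t, rfl⟩, rfl⟩
    exact ⟨t, (hπ.map_smul t a).symm⟩
  · refine Set.Subset.antisymm (fun p hp => hfib p hp) fun p hp => ?_
    refine (isAAPoint_iff_filter p).2 fun l _ y x₁ h1 h2 => ?_
    suffices h : π p = π x₁ by
      have : x₁ ∈ π ⁻¹' {π p} := h.symm
      rw [show π ⁻¹' {π p} = {p} from hp] at this
      exact this.symm
    rw [hker]
    intro E hE
    -- The intermediate point is `t⁻¹ • y`: it is close to `p` by invariance and to `x₁` by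
    -- convergence.
    obtain ⟨D, hD, hDE⟩ := @comp_mem_uniformity_sets X Z E hE
    obtain ⟨V, hV, hne, hVD⟩ := (hZ D).1 hD
    have e1 : ∀ᶠ t in l, (t • p, y) ∈ jointEntry T V :=
      (h1.prodMk_nhds tendsto_const_nhds).eventually
        ((isOpen_jointEntry hV).mem_nhds (diag_mem_jointEntry hV hne y))
    have e2 : ∀ᶠ t in l, (t⁻¹ • y, x₁) ∈ jointEntry T V :=
      (h2.prodMk_nhds tendsto_const_nhds).eventually
        ((isOpen_jointEntry hV).mem_nhds (diag_mem_jointEntry hV hne x₁))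
    obtain ⟨t, ht1, ht2⟩ := (e1.and e2).exists
    have := smul_mem_jointEntry ht1 t⁻¹
    rw [inv_smul_smul] at this
    exact hDE ⟨t⁻¹ • y, hVD this, hVD ht2⟩
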